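/- An inverse monoid is a monoid $M$ in which every element $x$ has a unique inverse, i.e. a unique element $x^{-1}$ with $xx^{-1}x=x$ and $x^{-1}xx^{-1}=x^{-1}$; it is monogenic if it is generated, as an inverse monoid, by a single element. A congruence $\rho$ on $M$ is idempotent-pure if $(s,e)\in\rho$ with $e$ idempotent implies that $s$ is idempotent, and $M$ is $E$-disjunctive if equality is its only idempotent-pure congruence. For $m\in\mathbb{N}$ let $A(m)$ be the number of isomorphism classes of monogenic inverse monoids with at most $m$ elements, and let $B(m)$ be the number of those isomorphism classes that consist of $E$-disjunctive monoids. Then $A(m)$ is finite for every $m$, $A(m)\geq 1$ for every $m\geq 1$, and $$\lim_{m\to\infty}\frac{B(m)}{A(m)}=0 .$$ -/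

import Mathlib

open Filter Topology

universe u

/-- `y` is an inverse of `x` in the sense of semigroup theory: `x y x = x` and `y x y = y`. -/
def IsSemigroupInverse {M : Type u} [Monoid M] (x y : M) : Prop :=
  x * y * x = x ∧ y * x * y = y

/-- `M` is an inverse monoid: every element has exactly one inverse. -/
def IsInverseMonoid (M : Type u) [Monoid M] : Prop :=
  ∀ x : M, ∃! y : M, IsSemigroupInverse x y

/-- A submonoid closed under taking inverses. In an inverse monoid these are the
inverse submonoids. -/
def IsInverseSubmonoid {M : Type u} [Monoid M] (N : Submonoid M) : Prop :=
  ∀ x ∈ N, ∀ y : M, IsSemigroupInverse x y → y ∈ N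

/-- `M` is a monogenic inverse monoid: an inverse monoid that is generated, as an inverse monoid,
by a single element `x`, that is, the only inverse submonoid containing `x` is `M` itself. -/
def IsMonogenicInverseMonoid (M : Type u) [Monoid M] : Prop :=
  IsInverseMonoid M ∧
    ∃ x : M, ∀ N : Submonoid M, IsInverseSubmonoid N → x ∈ N → N = ⊤

/-- A congruence is idempotent-pure if only idempotents are related to idempotents. -/
def IsIdempotentPure {M : Type u} [Monoid M] (c : Con M) : Prop :=
  ∀ s e : M, c s e → IsIdempotentElem e → IsIdempotentElem s

/-- `M` is `E`-disjunctive: its only idempotent-pure congruence is equality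
(`⊥` in the lattice of congruences). -/
def IsEDisjunctive (M : Type u) [Monoid M] : Prop :=
  ∀ c : Con M, IsIdempotentPure c → c = ⊥

/-- Isomorphism of monoids, as an equivalence relation. (Isomorphisms of monoids between inverse
monoids are the same as isomorphisms of inverse monoids.) -/
def monoidIsoSetoid : Setoid MonCat.{u} where
  r M N := Nonempty (M ≃* N)
  iseqv :=
    { refl := fun M => ⟨MulEquiv.refl M⟩
      symm := fun ⟨e⟩ => ⟨e.symm⟩
      trans := fun ⟨e⟩ ⟨f⟩ => ⟨e.trans f⟩ }

/-- The isomorphism classes of monoids. -/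
def MonoidIsoClass : Type (u + 1) := Quotient monoidIsoSetoid.{u}

/-- The isomorphism classes of monogenic inverse monoids with at most `m` elements. -/
def monogenicClasses (m : ℕ) : Set MonoidIsoClass.{u} :=
  {C | ∃ M : MonCat.{u}, Quotient.mk monoidIsoSetoid M = C ∧
    IsMonogenicInverseMonoid M ∧ Finite M ∧ Nat.card M ≤ m}

/-- The isomorphism classes of `E`-disjunctive monogenic inverse monoids with at most `m`
elements. -/
def eDisjunctiveMonogenicClasses (m : ℕ) : Set MonoidIsoClass.{u} :=
  {C | ∃ M : MonCat.{u}, Quotient.mk monoidIsoSetoid M = C ∧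
    IsMonogenicInverseMonoid M ∧ IsEDisjunctive M ∧ Finite M ∧ Nat.card M ≤ m}

/-! A word in `x` and `x⁻¹` is a walk on ℤ from 0, and its class in the free monogenic inverse
monoid records only the interval visited and the endpoint. Suppose a homomorphism to a finite
inverse monoid identifies two elements. Passing to `s s⁻¹` or `s⁻¹ s` gives an identification of two
intervals, and shifts, joins and finiteness spread it to all intervals at least as long as the
shorter one. So, with `n` the least length involved, shorter elements stay distinct and the others
collapse to a cyclic group of some order `p` (`exists_ker_eq_monogenicCon`). Power identities
recover `(n, p)` from the monoid (`forall_pow_eq_iff`), so counting classes is counting pairs.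

The order is at least `p` and roughly `n² / 4`, and at most `p` plus a cubic in `n`. For fixed `K`,
the pairs with `n ≤ K` already give about `(K + 1) m` classes, so `A` grows faster than linearly. If
`1 ≤ n ≤ p`, reducing endpoints modulo `p` is a nontrivial idempotent-pure congruence
(`not_isEDisjunctive`). Hence `E`-disjunctivity forces `n = 0` or `p < n ≤ 2√m`, which leaves only
`O(m)` pairs. -/

/-! ### The free monogenic inverse monoid as walks on ℤ -/

/-- The free monogenic inverse monoid: an integer interval `[lo, hi]` containing `0`, together
with a point `pos` of the interval. -/
@[ext]
structure FreeMonogenic where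
  lo : ℤ
  hi : ℤ
  pos : ℤ
  lo_nonpos : lo ≤ 0
  hi_nonneg : 0 ≤ hi
  lo_le_pos : lo ≤ pos
  pos_le_hi : pos ≤ hi

namespace FreeMonogenic

/-- Concatenation of walks: the second interval is translated to the endpoint of the first and the
union is taken. -/
instance : Monoid FreeMonogenic where
  mul u v := ⟨min u.lo (u.pos + v.lo), max u.hi (u.pos + v.hi), u.pos + v.pos,
    by have := u.lo_nonpos; omega, by have := u.hi_nonneg; omega,
    by have := v.lo_le_pos; omega, by have := v.pos_le_hi; omega⟩
  one := ⟨0, 0, 0, le_rfl, le_rfl, le_rfl, le_rfl⟩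
  mul_assoc u v w := by
    ext
    · change min (min u.lo (u.pos + v.lo)) (u.pos + v.pos + w.lo) =
        min u.lo (u.pos + min v.lo (v.pos + w.lo))
      omega
    · change max (max u.hi (u.pos + v.hi)) (u.pos + v.pos + w.hi) =
        max u.hi (u.pos + max v.hi (v.pos + w.hi))
      omega
    · exact add_assoc _ _ _
  one_mul u := by
    have := u.lo_nonpos
    have := u.hi_nonneg
    ext
    · change min 0 (0 + u.lo) = u.lo
      omega
    · change max 0 (0 + u.hi) = u.hi
      omega
    · exact zero_add _
  mul_one u := by
    have := u.lo_le_pos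
    have := u.pos_le_hi
    ext
    · change min u.lo (u.pos + 0) = u.lo
      omega
    · change max u.hi (u.pos + 0) = u.hi
      omega
    · exact add_zero _

@[simp] theorem mul_lo (u v : FreeMonogenic) : (u * v).lo = min u.lo (u.pos + v.lo) := rfl
@[simp] theorem mul_hi (u v : FreeMonogenic) : (u * v).hi = max u.hi (u.pos + v.hi) := rfl
@[simp] theorem mul_pos (u v : FreeMonogenic) : (u * v).pos = u.pos + v.pos := rfl
@[simp] theorem one_lo : (1 : FreeMonogenic).lo = 0 := rfl
@[simp] theorem one_hi : (1 : FreeMonogenic).hi = 0 := rfl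
@[simp] theorem one_pos : (1 : FreeMonogenic).pos = 0 := rfl

instance : Inv FreeMonogenic where
  inv u := ⟨u.lo - u.pos, u.hi - u.pos, -u.pos,
    by have := u.lo_le_pos; omega, by have := u.pos_le_hi; omega,
    by have := u.lo_nonpos; omega, by have := u.hi_nonneg; omega⟩

@[simp] theorem inv_lo (u : FreeMonogenic) : u⁻¹.lo = u.lo - u.pos := rfl
@[simp] theorem inv_hi (u : FreeMonogenic) : u⁻¹.hi = u.hi - u.pos := rfl
@[simp] theorem inv_pos (u : FreeMonogenic) : u⁻¹.pos = -u.pos := rfl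

theorem isSemigroupInverse_inv (u : FreeMonogenic) : IsSemigroupInverse u u⁻¹ := by
  have := u.lo_le_pos
  have := u.pos_le_hi
  have := u.lo_nonpos
  have := u.hi_nonneg
  constructor <;> ext <;> simp [*]

/-- The free generator. -/
def gen : FreeMonogenic := ⟨0, 1, 1, by omega, by omega, by omega, by omega⟩

@[simp] theorem gen_lo : gen.lo = 0 := rfl
@[simp] theorem gen_hi : gen.hi = 1 := rfl
@[simp] theorem gen_pos : gen.pos = 1 := rfl

/-- The idempotent with interval `[-a, b]`. -/
def idem (a b : ℕ) : FreeMonogenic :=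
  ⟨-a, b, 0, by omega, by omega, by omega, by omega⟩

@[simp] theorem idem_lo (a b : ℕ) : (idem a b).lo = -a := rfl
@[simp] theorem idem_hi (a b : ℕ) : (idem a b).hi = b := rfl
@[simp] theorem idem_pos (a b : ℕ) : (idem a b).pos = 0 := rfl

/-- The length of the interval. -/
def size (u : FreeMonogenic) : ℤ := u.hi - u.lo

theorem size_nonneg (u : FreeMonogenic) : 0 ≤ u.size := by
  have := u.lo_nonpos
  have := u.hi_nonneg
  simp only [size]
  omega

theorem size_le_mul_right (u v : FreeMonogenic) : u.size ≤ (u * v).size := by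
  simp only [size, mul_lo, mul_hi]
  omega

theorem size_le_mul_left (u v : FreeMonogenic) : v.size ≤ (u * v).size := by
  simp only [size, mul_lo, mul_hi]
  omega

theorem gen_pow (i : ℕ) : gen ^ i = ⟨0, i, i, by omega, by omega, by omega, by omega⟩ := by
  induction i with
  | zero => rfl
  | succ i ih =>
    rw [pow_succ, ih]
    ext <;> simp

theorem gen_inv_pow (i : ℕ) :
    gen⁻¹ ^ i = ⟨-i, 0, -i, by omega, by omega, by omega, by omega⟩ := by
  induction i with
  | zero => rfl
  | succ i ih =>
    rw [pow_succ, ih]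
    ext <;> simp <;> omega

theorem pow_pos_eq (u : FreeMonogenic) (i : ℕ) : (u ^ i).pos = i * u.pos := by
  induction i with
  | zero => simp
  | succ i ih => rw [pow_succ, mul_pos, ih]; push_cast; ring

theorem eq_idem_mul_of_pos_nonneg (u : FreeMonogenic) (h : 0 ≤ u.pos) :
    u = idem (-u.lo).toNat u.hi.toNat * gen ^ u.pos.toNat := by
  have := u.lo_le_pos
  have := u.pos_le_hi
  have := u.lo_nonpos
  have := u.hi_nonneg
  rw [gen_pow]
  ext <;> simp <;> omega

theorem eq_idem_mul_of_pos_nonpos (u : FreeMonogenic) (h : u.pos ≤ 0) :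
    u = idem (-u.lo).toNat u.hi.toNat * gen⁻¹ ^ (-u.pos).toNat := by
  have := u.lo_le_pos
  have := u.pos_le_hi
  have := u.lo_nonpos
  have := u.hi_nonneg
  rw [gen_inv_pow]
  ext <;> simp <;> omega

theorem idem_eq (a b : ℕ) : idem a b = gen⁻¹ ^ a * gen ^ a * (gen ^ b * gen⁻¹ ^ b) := by
  rw [gen_pow, gen_pow, gen_inv_pow, gen_inv_pow]
  ext <;> simp

theorem eq_top_of_gen_mem (N : Submonoid FreeMonogenic) (h : gen ∈ N) (h' : gen⁻¹ ∈ N) :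
    N = ⊤ := by
  refine eq_top_iff.2 fun u _ => ?_
  have hi : ∀ a b, idem a b ∈ N := fun a b => by
    rw [idem_eq]
    exact N.mul_mem (N.mul_mem (N.pow_mem h' _) (N.pow_mem h _))
      (N.mul_mem (N.pow_mem h _) (N.pow_mem h' _))
  rcases le_total 0 u.pos with hu | hu
  · rw [eq_idem_mul_of_pos_nonneg u hu]
    exact N.mul_mem (hi _ _) (N.pow_mem h _)
  · rw [eq_idem_mul_of_pos_nonpos u hu]
    exact N.mul_mem (hi _ _) (N.pow_mem h' _)

end FreeMonogenic

/-- The congruence that collapses all intervals of length at least `n` and identifies the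
positions in them modulo `p`. -/
def monogenicCon (n p : ℕ) : Con FreeMonogenic where
  r u v := u = v ∨ ((n : ℤ) ≤ u.size ∧ (n : ℤ) ≤ v.size ∧ u.pos ≡ v.pos [ZMOD p])
  iseqv :=
    { refl := fun u => Or.inl rfl
      symm := by
        rintro u v (rfl | ⟨h, h', h''⟩)
        · exact Or.inl rfl
        · exact Or.inr ⟨h', h, h''.symm⟩
      trans := by
        rintro u v w (rfl | ⟨h, h', h''⟩)
        · exact id
        · rintro (rfl | ⟨k, k', k''⟩)
          · exact Or.inr ⟨h, h', h''⟩
          · exact Or.inr ⟨h, k', h''.trans k''⟩ }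
  mul' := by
    -- Length never drops under multiplication on either side, so the long elements form an ideal.
    rintro u v w z (rfl | ⟨h, h', h''⟩) (rfl | ⟨k, k', k''⟩)
    · exact Or.inl rfl
    · exact Or.inr ⟨k.trans (FreeMonogenic.size_le_mul_left _ _),
        k'.trans (FreeMonogenic.size_le_mul_left _ _), k''.add_left _⟩
    · exact Or.inr ⟨h.trans (FreeMonogenic.size_le_mul_right _ _),
        h'.trans (FreeMonogenic.size_le_mul_right _ _), h''.add_right _⟩
    · exact Or.inr ⟨h.trans (FreeMonogenic.size_le_mul_right _ _),
        h'.trans (FreeMonogenic.size_le_mul_right _ _), h''.add k''⟩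

theorem monogenicCon_iff {n p : ℕ} {u v : FreeMonogenic} : monogenicCon n p u v ↔
    u = v ∨ ((n : ℤ) ≤ u.size ∧ (n : ℤ) ≤ v.size ∧ u.pos ≡ v.pos [ZMOD p]) := Iff.rfl

/-! ### Inverse monoids and commuting idempotents -/

section InverseMonoid

variable {M : Type u} [Monoid M]

theorem isInverseMonoid_of_commute (hreg : ∀ x : M, ∃ y, IsSemigroupInverse x y)
    (hcomm : ∀ e f : M, IsIdempotentElem e → IsIdempotentElem f → e * f = f * e) :
    IsInverseMonoid M := by
  intro x
  obtain ⟨y, hy⟩ := hreg x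
  refine ⟨y, hy, fun z hz => ?_⟩
  obtain ⟨y1, y2⟩ := hy
  obtain ⟨z1, z2⟩ := hz
  have hxy : IsIdempotentElem (x * y) := by rw [IsIdempotentElem, ← mul_assoc, y1]
  have hxz : IsIdempotentElem (x * z) := by rw [IsIdempotentElem, ← mul_assoc, z1]
  have hyx : IsIdempotentElem (y * x) := by rw [IsIdempotentElem, ← mul_assoc, y2]
  have hzx : IsIdempotentElem (z * x) := by rw [IsIdempotentElem, ← mul_assoc, z2]
  have h1 : y = y * x * z := by
    calc y = y * (x * z * x) * y := by rw [z1, y2]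
      _ = y * ((x * z) * (x * y)) := by simp only [mul_assoc]
      _ = y * ((x * y) * (x * z)) := by rw [hcomm _ _ hxz hxy]
      _ = (y * x * y) * (x * z) := by simp only [mul_assoc]
      _ = y * x * z := by rw [y2, mul_assoc]
  have h2 : z = y * x * z := by
    calc z = z * (x * y * x) * z := by rw [y1, z2]
      _ = ((z * x) * (y * x)) * z := by simp only [mul_assoc]
      _ = ((y * x) * (z * x)) * z := by rw [hcomm _ _ hzx hyx]
      _ = (y * x) * (z * x * z) := by simp only [mul_assoc]
      _ = y * x * z := by rw [z2]
  rw [h1, ← h2]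

theorem IsSemigroupInverse.symm {x y : M} (h : IsSemigroupInverse x y) :
    IsSemigroupInverse y x := ⟨h.2, h.1⟩

theorem IsSemigroupInverse.map {N : Type*} [Monoid N] {x y : M} (h : IsSemigroupInverse x y)
    (f : M →* N) : f x * f y * f x = f x ∧ f y * f x * f y = f y := by
  simp only [← map_mul]
  exact ⟨congrArg f h.1, congrArg f h.2⟩

theorem IsIdempotentElem.isSemigroupInverse_self {e : M} (h : IsIdempotentElem e) :
    IsSemigroupInverse e e := by
  have : e * e * e = e := by rw [h.eq, h.eq]
  exact ⟨this, this⟩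

/-- In an inverse monoid the product of two idempotents is idempotent. -/
theorem IsInverseMonoid.isIdempotentElem_mul (hM : IsInverseMonoid M) {e f : M}
    (he : IsIdempotentElem e) (hf : IsIdempotentElem f) : IsIdempotentElem (e * f) := by
  obtain ⟨z, ⟨z1, z2⟩, -⟩ := hM (e * f)
  have he' : ∀ t, e * (e * t) = e * t := fun t => by rw [← mul_assoc, he.eq]
  have hf' : ∀ t, f * (f * t) = f * t := fun t => by rw [← mul_assoc, hf.eq]
  simp only [mul_assoc] at z1 z2
  have z2' : ∀ t, z * (e * (f * (z * t))) = z * t := fun t => by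
    have := congrArg (· * t) z2
    simpa only [mul_assoc] using this
  -- This idempotent is its own inverse and also has `e * f` as an inverse; uniqueness makes them
  -- equal.
  have hid : IsIdempotentElem (f * (z * e)) := by
    simp only [IsIdempotentElem, mul_assoc]
    rw [z2']
  have hinv : IsSemigroupInverse (f * (z * e)) (e * f) := by
    constructor
    · simp only [mul_assoc]
      rw [he', hf', z2']
    · simp only [mul_assoc]
      rw [hf', he', z1]
  have := (hM (f * (z * e))).unique hinv hid.isSemigroupInverse_self
  rw [this]
  exact hid

/-- In an inverse monoid idempotents commute. -/
theorem IsInverseMonoid.idempotents_commute (hM : IsInverseMonoid M) {e f : M}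
    (he : IsIdempotentElem e) (hf : IsIdempotentElem f) : e * f = f * e := by
  have hef := hM.isIdempotentElem_mul he hf
  have hfe := hM.isIdempotentElem_mul hf he
  refine (hM (e * f)).unique hef.isSemigroupInverse_self ?_
  have he' : ∀ t, e * (e * t) = e * t := fun t => by rw [← mul_assoc, he.eq]
  have hf' : ∀ t, f * (f * t) = f * t := fun t => by rw [← mul_assoc, hf.eq]
  have h1 := hef.eq
  have h2 := hfe.eq
  simp only [mul_assoc] at h1 h2
  constructor
  · simp only [mul_assoc]
    rw [hf', he', h1]
  · simp only [mul_assoc]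
    rw [he', hf', h2]

end InverseMonoid

/-! ### The universal property -/

section InverseMonoid

variable {M : Type u} [Monoid M]

theorem IsSemigroupInverse.isIdempotentElem {x y : M} (h : IsSemigroupInverse x y) :
    IsIdempotentElem (x * y) := by
  rw [IsIdempotentElem, ← mul_assoc, h.1]

theorem IsSemigroupInverse.mul (hM : IsInverseMonoid M) {x y x' y' : M}
    (h : IsSemigroupInverse x y) (h' : IsSemigroupInverse x' y') :
    IsSemigroupInverse (x * x') (y' * y) := by
  have hc := hM.idempotents_commute h.symm.isIdempotentElem h'.isIdempotentElem
  constructor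
  · calc x * x' * (y' * y) * (x * x') = x * ((x' * y') * (y * x)) * x' := by
          simp only [mul_assoc]
      _ = (x * y * x) * (x' * y' * x') := by rw [← hc]; simp only [mul_assoc]
      _ = x * x' := by rw [h.1, h'.1]
  · calc y' * y * (x * x') * (y' * y) = y' * ((y * x) * (x' * y')) * y := by
          simp only [mul_assoc]
      _ = (y' * x' * y') * (y * x * y) := by rw [hc]; simp only [mul_assoc]
      _ = y' * y := by rw [h.2, h'.2]

theorem IsSemigroupInverse.pow (hM : IsInverseMonoid M) {x y : M}
    (h : IsSemigroupInverse x y) (i : ℕ) : IsSemigroupInverse (x ^ i) (y ^ i) := by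
  induction i with
  | zero =>
    rw [pow_zero, pow_zero]
    exact IsIdempotentElem.one.isSemigroupInverse_self
  | succ i ih =>
    rw [pow_succ, pow_succ']
    exact ih.mul hM h

/-- Moving `x` to the right end shortens the left arm of the interval by one; truncated subtraction
is right at `a = 0`, where there is no arm to shorten. -/
theorem IsSemigroupInverse.mul_pow_mul_pow (hM : IsInverseMonoid M) {x y : M}
    (h : IsSemigroupInverse x y) (a : ℕ) :
    x * (y ^ a * x ^ a) = y ^ (a - 1) * x ^ (a - 1) * x := by
  cases a with
  | zero => simp
  | succ s =>
    have hc := hM.idempotents_commute h.isIdempotentElem (h.pow hM s).symm.isIdempotentElem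
    calc x * (y ^ (s + 1) * x ^ (s + 1)) = (x * y * (y ^ s * x ^ s)) * x := by
          rw [pow_succ', pow_succ]; simp only [mul_assoc]
      _ = y ^ s * x ^ s * (x * y * x) := by rw [hc]; simp only [mul_assoc]
      _ = y ^ s * x ^ s * x := by rw [h.1]

theorem IsSemigroupInverse.mul_pow_mul_pow' (hM : IsInverseMonoid M) {x y : M}
    (h : IsSemigroupInverse x y) (b : ℕ) :
    x * (x ^ b * y ^ b) = x ^ (b + 1) * y ^ (b + 1) * x := by
  have hc := hM.idempotents_commute h.symm.isIdempotentElem (h.pow hM b).isIdempotentElem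
  calc x * (x ^ b * y ^ b) = x * ((y * x) * (x ^ b * y ^ b)) := by
        rw [← mul_assoc x (y * x), ← mul_assoc x y x, h.1]
    _ = x ^ (b + 1) * y ^ (b + 1) * x := by
        rw [hc, pow_succ', pow_succ]; simp only [mul_assoc]

/-- The integer power of an element `x` with inverse `y`. -/
def inversePow (x y : M) (k : ℤ) : M := x ^ k.toNat * y ^ (-k).toNat

theorem inversePow_neg (x y : M) (k : ℤ) : inversePow x y (-k) = inversePow y x k := by
  rcases le_total 0 k with h | h
  · have h' : (-k).toNat = 0 := by omega
    simp [inversePow, h']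
  · have h' : k.toNat = 0 := by omega
    simp [inversePow, h']

/-- For negative `k` the product creates a factor `x * y`, which the idempotent `x ^ (b + 1) * y ^
(b + 1)` absorbs. -/
theorem IsSemigroupInverse.mul_inversePow (hM : IsInverseMonoid M) {x y : M}
    (h : IsSemigroupInverse x y) (b : ℕ) (k : ℤ) :
    x ^ (b + 1) * y ^ (b + 1) * (x * inversePow x y k) =
      x ^ (b + 1) * y ^ (b + 1) * inversePow x y (1 + k) := by
  rcases le_or_gt 0 k with hk | hk
  · have h1 : (1 + k).toNat = k.toNat + 1 := by omega
    have h2 : (-k).toNat = 0 := by omega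
    have h3 : (-(1 + k)).toNat = 0 := by omega
    simp only [inversePow, h1, h2, h3, pow_zero, mul_one, pow_succ' x k.toNat]
  · have h1 : k.toNat = 0 := by omega
    have h2 : (1 + k).toNat = 0 := by omega
    have h3 : (-k).toNat = (-(1 + k)).toNat + 1 := by omega
    simp only [inversePow, h1, h2, h3, pow_zero, one_mul]
    have hc := hM.idempotents_commute h.isIdempotentElem (h.pow hM (b + 1)).isIdempotentElem
    have hE : x ^ (b + 1) * y ^ (b + 1) * (x * y) = x ^ (b + 1) * y ^ (b + 1) := by
      rw [← hc]
      calc x * y * (x ^ (b + 1) * y ^ (b + 1)) = x * y * x * (x ^ b * y ^ (b + 1)) := by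
            rw [pow_succ' x]; simp only [mul_assoc]
        _ = x ^ (b + 1) * y ^ (b + 1) := by rw [h.1, pow_succ' x, mul_assoc]
    rw [pow_succ' y (-(1 + k)).toNat, ← mul_assoc x, ← mul_assoc, hE]

/-- The value of the canonical map from the free monogenic inverse monoid. -/
def freeMonogenicEval (x y : M) (u : FreeMonogenic) : M :=
  (y ^ (-u.lo).toNat * x ^ (-u.lo).toNat) * (x ^ u.hi.toNat * y ^ u.hi.toNat) *
    inversePow x y u.pos

theorem freeMonogenicEval_gen_mul (hM : IsInverseMonoid M) {x y : M}
    (h : IsSemigroupInverse x y) (u : FreeMonogenic) :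
    freeMonogenicEval x y (FreeMonogenic.gen * u) = x * freeMonogenicEval x y u := by
  have h0 := u.hi_nonneg
  have h1 : (-(FreeMonogenic.gen * u).lo).toNat = (-u.lo).toNat - 1 := by
    simp; omega
  have h2 : (FreeMonogenic.gen * u).hi.toNat = u.hi.toNat + 1 := by
    simp; omega
  have h3 : (FreeMonogenic.gen * u).pos = 1 + u.pos := rfl
  rw [freeMonogenicEval, freeMonogenicEval, h1, h2, h3, mul_assoc (y ^ _ * x ^ _),
    ← h.mul_inversePow hM, ← mul_assoc (x ^ _ * y ^ _), ← h.mul_pow_mul_pow' hM,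
    ← mul_assoc (y ^ _ * x ^ _), ← mul_assoc (y ^ _ * x ^ _), ← h.mul_pow_mul_pow hM]
  simp only [mul_assoc]

/-- The mirror image of the previous case: commuting the two idempotent factors exchanges the roles
of `x` and `y`. -/
theorem freeMonogenicEval_inv_mul (hM : IsInverseMonoid M) {x y : M}
    (h : IsSemigroupInverse x y) (u : FreeMonogenic) :
    freeMonogenicEval x y (FreeMonogenic.gen⁻¹ * u) = y * freeMonogenicEval x y u := by
  have h0 := u.lo_nonpos
  have h1 : (-(FreeMonogenic.gen⁻¹ * u).lo).toNat = (-u.lo).toNat + 1 := by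
    simp; omega
  have h2 : (FreeMonogenic.gen⁻¹ * u).hi.toNat = u.hi.toNat - 1 := by
    simp; omega
  have h3 : inversePow x y (FreeMonogenic.gen⁻¹ * u).pos = inversePow y x (1 + -u.pos) := by
    rw [← inversePow_neg]
    congr 1
    simp; ring
  have h4 : inversePow x y u.pos = inversePow y x (-u.pos) := by rw [inversePow_neg]
  have hc : ∀ a b : ℕ, y ^ a * x ^ a * (x ^ b * y ^ b) = x ^ b * y ^ b * (y ^ a * x ^ a) :=
    fun a b => hM.idempotents_commute (h.pow hM a).symm.isIdempotentElem
      (h.pow hM b).isIdempotentElem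
  rw [freeMonogenicEval, freeMonogenicEval, h1, h2, h3, h4, hc, hc, mul_assoc (x ^ _ * y ^ _),
    ← h.symm.mul_inversePow hM, ← mul_assoc (y ^ _ * x ^ _), ← h.symm.mul_pow_mul_pow' hM,
    ← mul_assoc (x ^ _ * y ^ _), ← mul_assoc (x ^ _ * y ^ _), ← h.symm.mul_pow_mul_pow hM]
  simp only [mul_assoc]

/-- The universal property of the free monogenic inverse monoid. -/
def freeMonogenicLift (hM : IsInverseMonoid M) {x y : M} (h : IsSemigroupInverse x y) :
    FreeMonogenic →* M where
  toFun := freeMonogenicEval x y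
  map_one' := by simp [freeMonogenicEval, inversePow]
  map_mul' u v := by
    -- The left factors that multiply correctly with every `v` form a submonoid, so only the
    -- generator and its inverse need checking.
    let N : Submonoid FreeMonogenic :=
      { carrier := {u | ∀ v, freeMonogenicEval x y (u * v) =
          freeMonogenicEval x y u * freeMonogenicEval x y v}
        one_mem' := fun v => by simp [freeMonogenicEval, inversePow]
        mul_mem' := fun {u u'} hu hu' v => by rw [mul_assoc, hu, hu', hu, mul_assoc] }
    have h1 : freeMonogenicEval x y 1 = 1 := by simp [freeMonogenicEval, inversePow]
    have hN : N = ⊤ := by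
      refine FreeMonogenic.eq_top_of_gen_mem N (fun v => ?_) (fun v => ?_)
      · have := freeMonogenicEval_gen_mul hM h 1
        rw [mul_one, h1, mul_one] at this
        rw [freeMonogenicEval_gen_mul hM h, this]
      · have := freeMonogenicEval_inv_mul hM h 1
        rw [mul_one, h1, mul_one] at this
        rw [freeMonogenicEval_inv_mul hM h, this]
    have hu : u ∈ N := hN ▸ Submonoid.mem_top u
    exact hu v

theorem freeMonogenicLift_gen (hM : IsInverseMonoid M) {x y : M} (h : IsSemigroupInverse x y) :
    freeMonogenicLift hM h FreeMonogenic.gen = x := by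
  have := freeMonogenicEval_gen_mul hM h 1
  rw [mul_one] at this
  change freeMonogenicEval x y _ = x
  rw [this]
  simp [freeMonogenicEval, inversePow]

theorem IsMonogenicInverseMonoid.exists_surjective (hM : IsMonogenicInverseMonoid M) :
    ∃ f : FreeMonogenic →* M, Function.Surjective f := by
  obtain ⟨hM, x, hx⟩ := hM
  obtain ⟨y, hy, -⟩ := hM x
  refine ⟨freeMonogenicLift hM hy, ?_⟩
  rw [← MonoidHom.mrange_eq_top]
  refine hx _ ?_ ⟨_, freeMonogenicLift_gen hM hy⟩
  rintro _ ⟨u, rfl⟩ z hz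
  exact ⟨u⁻¹, (hM _).unique (u.isSemigroupInverse_inv.map _) hz⟩

end InverseMonoid

/-! ### Identifications between intervals -/

namespace FreeMonogenic

theorem idem_mul_idem (a b c d : ℕ) : idem a b * idem c d = idem (max a c) (max b d) := by
  ext <;> simp

/-- Conjugation translates the interval by one, then adjoins 0 again; hence the truncated `a - 1`.
-/
theorem gen_mul_idem_mul (a b : ℕ) : gen * idem a b * gen⁻¹ = idem (a - 1) (b + 1) := by
  ext <;> simp <;> omega

theorem gen_inv_mul_idem_mul (a b : ℕ) : gen⁻¹ * idem a b * gen = idem (a + 1) (b - 1) := by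
  ext <;> simp
  omega

theorem gen_pow_mul_inv (i : ℕ) : gen ^ i * (gen ^ i)⁻¹ = idem 0 i := by
  rw [gen_pow]
  ext <;> simp

theorem gen_pow_inv_mul (i : ℕ) : (gen ^ i)⁻¹ * gen ^ i = idem i 0 := by
  rw [gen_pow]
  ext <;> simp

theorem mul_inv_eq_idem (u : FreeMonogenic) :
    u * u⁻¹ = idem (-u.lo).toNat u.hi.toNat := by
  have := u.lo_nonpos
  have := u.hi_nonneg
  ext <;> simp <;> omega

theorem inv_mul_eq_idem (u : FreeMonogenic) :
    u⁻¹ * u = idem (u.pos - u.lo).toNat (u.hi - u.pos).toNat := by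
  have := u.lo_le_pos
  have := u.pos_le_hi
  ext <;> simp <;> omega

/-- An element with prescribed position and interval of length at least `n`. -/
def long (n : ℕ) (k : ℤ) : FreeMonogenic :=
  ⟨min 0 k - n, max 0 k, k, by omega, by omega, by omega, by omega⟩

@[simp] theorem long_pos (n : ℕ) (k : ℤ) : (long n k).pos = k := rfl

theorem le_size_long (n : ℕ) (k : ℤ) : (n : ℤ) ≤ (long n k).size := by
  simp only [size, long]
  omega

end FreeMonogenic

open FreeMonogenic

/-- If a map on intervals `[-a, b]` is compatible with joins and shifts, and one equality
between an interval of length `n` and its extension to the left holds, as well as one equality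
between an interval and its extension to the right, then intervals of length at least `n` may be
extended in both directions. -/
theorem extend_of_extend {M : Type u} (g : ℕ → ℕ → M)
    (hjoin : ∀ a b a' b' c d, g a b = g a' b' →
      g (max a c) (max b d) = g (max a' c) (max b' d))
    (hshift : ∀ a b a' b', g a b = g a' b' → g (a - 1) (b + 1) = g (a' - 1) (b' + 1))
    (hshift' : ∀ a b a' b', g a b = g a' b' → g (a + 1) (b - 1) = g (a' + 1) (b' - 1))
    {i : ℕ} (hi : ∀ j, i ≤ j → g 0 j = g 0 (j + 1)) {a b : ℕ} (hab : g a b = g (a + 1) b)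
    (a' b' : ℕ) (h : a + b ≤ a' + b') :
    g a' b' = g (a' + 1) b' ∧ g a' b' = g a' (b' + 1) := by
  have hs : ∀ s a b a' b', g a b = g a' b' → g (a - s) (b + s) = g (a' - s) (b' + s) := by
    intro s
    induction s with
    | zero => intro a b a' b' h; simpa using h
    | succ s ih =>
      intro a b a' b' h
      exact hshift _ _ _ _ (ih _ _ _ _ h)
  have hs' : ∀ s a b a' b', g a b = g a' b' → g (a + s) (b - s) = g (a' + s) (b' - s) := by
    intro s
    induction s with
    | zero => intro a b a' b' h; simpa using h
    | succ s ih =>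
      intro a b a' b' h
      exact hshift' _ _ _ _ (ih _ _ _ _ h)
  have hleft : ∀ a' b', a + b ≤ a' + b' → g a' b' = g (a' + 1) b' := by
    intro a' b' h
    -- Shift the given equality until its left ends are `a'` and `a' + 1`, then enlarge the right
    -- end to `b'` by a join.
    rcases le_total a' a with h' | h'
    · have := hjoin _ _ _ _ 0 b' (hs (a - a') _ _ _ _ hab)
      convert this using 1 <;> congr 1 <;> omega
    · have := hjoin _ _ _ _ 0 b' (hs' (a' - a) _ _ _ _ hab)
      convert this using 1 <;> congr 1 <;> omega
  have hleft' : ∀ t a' b', a + b ≤ a' + b' → g a' b' = g (a' + t) b' := by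
    intro t
    induction t with
    | zero => intro a' b' _; rfl
    | succ t ih =>
      intro a' b' h
      rw [ih _ _ h, hleft (a' + t) b' (by omega)]
      rfl
  refine ⟨hleft a' b' h, ?_⟩
  -- A right extension is known far out by `hi`; shift it back by `i + a'` and remove the surplus
  -- `i` on the left by `hleft'`.
  have h1 : g 0 (i + a' + b') = g 0 (i + a' + b' + 1) := hi _ (by omega)
  have h2 := hs' (i + a') _ _ _ _ h1
  rw [hleft' i a' b' h, hleft' i a' (b' + 1) (by omega)]
  convert h2 using 1 <;> congr 1 <;> omega

/-! ### Kernels of homomorphisms to finite inverse monoids -/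

section Kernel

variable {M : Type u} [Monoid M] (f : FreeMonogenic →* M)

theorem exists_pow_eq [Finite M] : ∃ i j : ℕ, i < j ∧ f (gen ^ i) = f (gen ^ j) := by
  obtain ⟨i, j, hij, h⟩ := Finite.exists_ne_map_eq_of_infinite fun i : ℕ => f (gen ^ i)
  rcases lt_or_gt_of_ne hij with h' | h'
  · exact ⟨i, j, h', h⟩
  · exact ⟨j, i, h', h.symm⟩

variable {f}

theorem map_inv_eq (hM : IsInverseMonoid M) {u v : FreeMonogenic} (h : f u = f v) :
    f u⁻¹ = f v⁻¹ :=
  (hM (f u)).unique (u.isSemigroupInverse_inv.map f)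
    (by rw [h]; exact v.isSemigroupInverse_inv.map f)

theorem map_idem_join {a b a' b' : ℕ} (c d : ℕ) (h : f (idem a b) = f (idem a' b')) :
    f (idem (max a c) (max b d)) = f (idem (max a' c) (max b' d)) := by
  rw [← idem_mul_idem, ← idem_mul_idem, map_mul, map_mul, h]

theorem map_idem_shift {a b a' b' : ℕ} (h : f (idem a b) = f (idem a' b')) :
    f (idem (a - 1) (b + 1)) = f (idem (a' - 1) (b' + 1)) := by
  rw [← gen_mul_idem_mul, ← gen_mul_idem_mul]
  simp only [map_mul, h]

theorem map_idem_shift' {a b a' b' : ℕ} (h : f (idem a b) = f (idem a' b')) :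
    f (idem (a + 1) (b - 1)) = f (idem (a' + 1) (b' - 1)) := by
  rw [← gen_inv_mul_idem_mul, ← gen_inv_mul_idem_mul]
  simp only [map_mul, h]

/-- Joining both sides with the intermediate interval changes the smaller one into it and leaves the
larger one alone. -/
theorem map_idem_squeeze {a b a' b' : ℕ} (h : f (idem a b) = f (idem a' b')) {c d : ℕ}
    (hc : a ≤ c) (hd : b ≤ d) (hc' : c ≤ a') (hd' : d ≤ b') :
    f (idem a b) = f (idem c d) := by
  have := map_idem_join c d h
  rw [max_eq_right hc, max_eq_right hd, max_eq_left hc', max_eq_left hd'] at this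
  rw [this, h]

/-- Finiteness makes the powers of the generator eventually periodic; taking `s s⁻¹` and `s⁻¹ s` of
equal powers and squeezing gives one-step extensions. -/
theorem exists_extend_right [Finite M] (hM : IsInverseMonoid M) :
    ∃ i : ℕ, ∀ j, i ≤ j → f (idem 0 j) = f (idem 0 (j + 1)) ∧ f (idem j 0) = f (idem (j + 1) 0) := by
  obtain ⟨i, k, hik, h⟩ := exists_pow_eq f
  refine ⟨i, fun j hj => ?_⟩
  have h' : f (gen ^ j) = f (gen ^ (j + (k - i))) := by
    have e : j + (k - i) = k + (j - i) := by omega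
    have e' : j = i + (j - i) := by omega
    rw [e]
    conv_lhs => rw [e']
    rw [pow_add, pow_add, map_mul, map_mul, h]
  have hr : f (idem 0 j) = f (idem 0 (j + (k - i))) := by
    rw [← gen_pow_mul_inv, ← gen_pow_mul_inv, map_mul, map_mul, map_inv_eq hM h', h']
  have hl : f (idem j 0) = f (idem (j + (k - i)) 0) := by
    rw [← gen_pow_inv_mul, ← gen_pow_inv_mul, map_mul, map_mul, map_inv_eq hM h', h']
  exact ⟨map_idem_squeeze hr le_rfl (by omega) le_rfl (by omega),
    map_idem_squeeze hl (by omega) le_rfl (by omega) le_rfl⟩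

/-- If some nontrivial identification involves an interval of length `n`, then all intervals of
length at least `n` are identified. -/
theorem map_idem_eq_of_le [Finite M] (hM : IsInverseMonoid M) {a b a₁ b₁ : ℕ}
    (h : f (idem a b) = f (idem a₁ b₁)) (hne : a < a₁ ∨ b < b₁) {c d c' d' : ℕ}
    (hcd : a + b ≤ c + d) (hcd' : a + b ≤ c' + d') : f (idem c d) = f (idem c' d') := by
  obtain ⟨i, hi⟩ := exists_extend_right (f := f) hM
  have key : ∀ a' b', a + b ≤ a' + b' →
      f (idem a' b') = f (idem (a' + 1) b') ∧ f (idem a' b') = f (idem a' (b' + 1)) := by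
    -- After this join the second interval contains the first, as squeezing requires.
    have hj := map_idem_join a b h
    rw [max_self, max_self] at hj
    rcases hne with hne | hne
    · refine extend_of_extend (fun a b => f (idem a b)) (fun _ _ _ _ _ _ => map_idem_join _ _)
        (fun _ _ _ _ => map_idem_shift) (fun _ _ _ _ => map_idem_shift')
        (fun j hj => (hi j hj).1) ?_
      exact map_idem_squeeze hj (by omega) le_rfl (by omega) (by omega)
    · intro a' b' hab
      refine (extend_of_extend (fun b a => f (idem a b)) (fun _ _ _ _ _ _ => map_idem_join _ _)
        (fun _ _ _ _ => map_idem_shift') (fun _ _ _ _ => map_idem_shift)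
        (fun j hj => (hi j hj).2) (a := b) (b := a) ?_ b' a' (by omega)).symm
      exact map_idem_squeeze hj le_rfl (by omega) (by omega) (by omega)
  have key' : ∀ s t a' b', a + b ≤ a' + b' → f (idem a' b') = f (idem (a' + s) (b' + t)) := by
    intro s t a' b' hab
    have h1 : f (idem a' b') = f (idem (a' + s) b') := by
      induction s with
      | zero => rfl
      | succ s ih => rw [ih, (key (a' + s) b' (by omega)).1]; rfl
    rw [h1]
    induction t with
    | zero => rfl
    | succ t ih => rw [ih, (key (a' + s) (b' + t) (by omega)).2]; rfl
  -- Both intervals are compared with the common enlargement `[-(c + c'), d + d']`.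
  rw [key' c' d' c d hcd, key' c d c' d' hcd', add_comm c, add_comm d]

/-- If the intervals differ, `s s⁻¹` sees it; if only the endpoints differ, `s⁻¹ s` gives different
translates of the same interval. As `v` is no shorter than `u`, its interval sticks out on some
side. -/
theorem exists_map_idem_eq (hM : IsInverseMonoid M) {u v : FreeMonogenic} (h : f u = f v)
    (hne : u ≠ v) (hsize : u.size ≤ v.size) : ∃ a b a' b' : ℕ,
      ((a + b : ℕ) : ℤ) = u.size ∧ (a < a' ∨ b < b') ∧ f (idem a b) = f (idem a' b') := by
  have hu1 := u.lo_le_pos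
  have hu2 := u.pos_le_hi
  have hu3 := u.lo_nonpos
  have hu4 := u.hi_nonneg
  have hv1 := v.lo_le_pos
  have hv2 := v.pos_le_hi
  have hv3 := v.lo_nonpos
  have hv4 := v.hi_nonneg
  have hinv := map_inv_eq hM h
  simp only [size] at hsize ⊢
  by_cases hlh : u.lo = v.lo ∧ u.hi = v.hi
  · have hp : u.pos ≠ v.pos := fun hp => hne (FreeMonogenic.ext hlh.1 hlh.2 hp)
    have key : f (u⁻¹ * u) = f (v⁻¹ * v) := by rw [map_mul, map_mul, h, hinv]
    rw [inv_mul_eq_idem, inv_mul_eq_idem] at key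
    exact ⟨_, _, _, _, by omega, by omega, key⟩
  · have key : f (u * u⁻¹) = f (v * v⁻¹) := by rw [map_mul, map_mul, h, hinv]
    rw [mul_inv_eq_idem, mul_inv_eq_idem] at key
    exact ⟨_, _, _, _, by omega, by omega, key⟩

/-- The kernel of a homomorphism from the free monogenic inverse monoid to a finite inverse
monoid. -/
theorem exists_ker_eq_monogenicCon [Finite M] (hM : IsInverseMonoid M) :
    ∃ n p : ℕ, 0 < p ∧ ∀ u v, f u = f v ↔ monogenicCon n p u v := by
  classical
  obtain ⟨i, j, hij, hpow⟩ := exists_pow_eq f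
  have hex : ∃ N : ℕ, ∃ u v : FreeMonogenic, u ≠ v ∧ f u = f v ∧ u.size = N := by
    refine ⟨_, gen ^ i, gen ^ j, fun h => ?_, hpow, (Int.toNat_of_nonneg (size_nonneg _)).symm⟩
    rw [gen_pow, gen_pow] at h
    have := congrArg FreeMonogenic.pos h
    simp only at this
    omega
  -- `n` is the least length occurring in a nontrivial identification.
  obtain ⟨n, ⟨u₀, v₀, hne, h₀, hn⟩, hmin⟩ : ∃ n : ℕ,
      (∃ u v : FreeMonogenic, u ≠ v ∧ f u = f v ∧ u.size = n) ∧
      ∀ u v : FreeMonogenic, u ≠ v → f u = f v → (n : ℤ) ≤ u.size := by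
    refine ⟨Nat.find hex, Nat.find_spec hex, fun u v hne h => ?_⟩
    have h0 := size_nonneg u
    have := Nat.find_min' hex ⟨u, v, hne, h, (Int.toNat_of_nonneg h0).symm⟩
    omega
  obtain ⟨a, b, a', b', hab, hlt, h₁⟩ :=
    exists_map_idem_eq hM h₀ hne (hn ▸ hmin v₀ u₀ hne.symm h₀.symm)
  have hab' : a + b = n := by omega
  have hlong : ∀ u v : FreeMonogenic, (n : ℤ) ≤ u.size → (n : ℤ) ≤ v.size → u.pos = v.pos →
      f u = f v := by
    intro u v hu hv hp
    have hid : f (idem (-u.lo).toNat u.hi.toNat) = f (idem (-v.lo).toNat v.hi.toNat) := by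
      have hu3 := u.lo_nonpos
      have hu4 := u.hi_nonneg
      have hv3 := v.lo_nonpos
      have hv4 := v.hi_nonneg
      simp only [size] at hu hv
      exact map_idem_eq_of_le hM h₁ hlt (by omega) (by omega)
    rcases le_total 0 u.pos with h | h
    · rw [eq_idem_mul_of_pos_nonneg u h, eq_idem_mul_of_pos_nonneg v (hp ▸ h), map_mul, map_mul,
        hid, hp]
    · rw [eq_idem_mul_of_pos_nonpos u h, eq_idem_mul_of_pos_nonpos v (hp ▸ h), map_mul, map_mul,
        hid, hp]
  have hmul : ∀ k l, f (long n k) * f (long n l) = f (long n (k + l)) := fun k l => by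
    rw [← map_mul]
    exact hlong _ _ ((le_size_long n k).trans (size_le_mul_right _ _)) (le_size_long _ _) rfl
  -- By `hlong`, long elements depend only on their position, so they form a quotient group of ℤ;
  -- `H` is the kernel, and `p` will be its generator up to sign.
  let H : AddSubgroup ℤ :=
    { carrier := {k | f (long n k) = f (long n 0)}
      zero_mem' := rfl
      add_mem' := fun {k l} hk hl => by
        change f _ = f _
        rw [← hmul, hk, hl, hmul, add_zero]
      neg_mem' := fun {k} hk => by
        change f _ = f _
        have hk' : f _ = f _ := hk
        rw [← add_zero (-k), ← hmul, ← hk', hmul, neg_add_cancel, hk'] }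
  have hH : ∀ k l, f (long n k) = f (long n l) ↔ l - k ∈ H := fun k l => by
    change _ ↔ f _ = f _
    constructor
    · intro h
      rw [sub_eq_add_neg, ← hmul, ← h, hmul, add_neg_cancel]
    · intro h
      have := congrArg (f (long n k) * ·) h
      simp only [hmul, add_sub_cancel, add_zero] at this
      exact this.symm
  obtain ⟨q, hq⟩ := Int.subgroup_cyclic H
  rw [← AddSubgroup.zmultiples_eq_closure] at hq
  have hHq : ∀ k, k ∈ H ↔ (q.natAbs : ℤ) ∣ k := fun k => by
    rw [hq, Int.mem_zmultiples_iff, Int.natAbs_dvd]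
  refine ⟨n, q.natAbs, ?_, fun u v => ?_⟩
  -- `H` is nonzero because two distinct powers of the generator have the same image.
  · have hmem : (j : ℤ) - i ∈ H := by
      rw [← hH]
      have h1 : ∀ t : ℕ, f (long n t) = f (gen ^ t) * f (long n 0) := fun t => by
        rw [← map_mul]
        refine hlong _ _ (le_size_long _ _) ((le_size_long n 0).trans (size_le_mul_left _ _)) ?_
        rw [gen_pow]
        simp
      rw [h1, h1, hpow]
    rw [hHq] at hmem
    rcases Nat.eq_zero_or_pos q.natAbs with h | h
    · rw [h, Nat.cast_zero, zero_dvd_iff] at hmem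
      omega
    · exact h
  · have hl : ∀ u : FreeMonogenic, (n : ℤ) ≤ u.size → f u = f (long n u.pos) := fun u hu =>
      hlong _ _ hu (le_size_long _ _) rfl
    have hiff : (n : ℤ) ≤ u.size → (n : ℤ) ≤ v.size →
        (f u = f v ↔ u.pos ≡ v.pos [ZMOD (q.natAbs : ℕ)]) := fun hu hv => by
      rw [hl u hu, hl v hv, hH, hHq, Int.modEq_iff_dvd]
    rw [monogenicCon_iff]
    constructor
    · intro h
      by_cases huv : u = v
      · exact Or.inl huv
      · have hu := hmin u v huv h
        have hv := hmin v u (Ne.symm huv) h.symm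
        exact Or.inr ⟨hu, hv, (hiff hu hv).1 h⟩
    · rintro (rfl | ⟨hu, hv, h⟩)
      · rfl
      · exact (hiff hu hv).2 h

end Kernel

/-! ### Presentations and the invariants `n` and `p` -/

open FreeMonogenic

/-- `f` presents `M` as the quotient of the free monogenic inverse monoid by
`monogenicCon n p`. -/
structure IsMonogenicPresentation {M : Type u} [Monoid M] (f : FreeMonogenic →* M) (n p : ℕ) :
    Prop where
  surjective : Function.Surjective f
  eq_iff : ∀ u v, f u = f v ↔ monogenicCon n p u v

namespace IsMonogenicPresentation

variable {M : Type u} [Monoid M] {f : FreeMonogenic →* M} {n p : ℕ}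

theorem isIdempotentElem_iff (h : IsMonogenicPresentation f n p) (u : FreeMonogenic) :
    IsIdempotentElem (f u) ↔ u.pos = 0 ∨ ((n : ℤ) ≤ u.size ∧ (p : ℤ) ∣ u.pos) := by
  rw [IsIdempotentElem, ← map_mul, h.eq_iff, monogenicCon_iff, Int.modEq_comm,
    Int.modEq_iff_dvd]
  have hs := size_le_mul_right u u
  have e : (u * u).pos - u.pos = u.pos := by rw [mul_pos]; ring
  rw [e]
  constructor
  · rintro (h' | ⟨-, h1, h2⟩)
    · left
      have := congrArg FreeMonogenic.pos h'
      rw [mul_pos] at this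
      omega
    · exact Or.inr ⟨h1, h2⟩
  · rintro (h' | ⟨h1, h2⟩)
    · left
      have := u.lo_nonpos
      have := u.hi_nonneg
      ext <;> simp [h']
    · exact Or.inr ⟨h1.trans hs, h1, h2⟩

theorem isMonogenicInverseMonoid (h : IsMonogenicPresentation f n p) :
    IsMonogenicInverseMonoid M := by
  refine ⟨isInverseMonoid_of_commute (fun x => ?_) (fun e e' he he' => ?_), f gen,
    fun N hN hgen => ?_⟩
  · obtain ⟨u, rfl⟩ := h.surjective x
    exact ⟨f u⁻¹, u.isSemigroupInverse_inv.map f⟩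
  · obtain ⟨u, rfl⟩ := h.surjective e
    obtain ⟨v, rfl⟩ := h.surjective e'
    rw [h.isIdempotentElem_iff] at he he'
    rw [← map_mul, ← map_mul, h.eq_iff, monogenicCon_iff]
    have hp : (u * v).pos ≡ (v * u).pos [ZMOD p] := by
      rw [mul_pos, mul_pos, add_comm]
    rcases he with he | ⟨he, -⟩
    · rcases he' with he' | ⟨he', -⟩
      · left
        ext
        · simp [he, he', min_comm]
        · simp [he, he', max_comm]
        · simp [he, he']
      · exact Or.inr ⟨he'.trans (size_le_mul_left _ _), he'.trans (size_le_mul_right _ _), hp⟩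
    · exact Or.inr ⟨he.trans (size_le_mul_right _ _), he.trans (size_le_mul_left _ _), hp⟩
  · have := eq_top_of_gen_mem (N.comap f) hgen
      (hN _ hgen _ (gen.isSemigroupInverse_inv.map f))
    refine eq_top_iff.2 fun x _ => ?_
    obtain ⟨u, rfl⟩ := h.surjective x
    have hu : u ∈ N.comap f := this ▸ Submonoid.mem_top u
    exact hu

/-- This makes `(n, p)` an isomorphism invariant. The `i`-th power of the generator has length
exactly `i`, whereas powers of any element with nonzero position are at least that long, and
elements at position 0 are idempotent. -/
theorem forall_pow_eq_iff (h : IsMonogenicPresentation f n p) {i q : ℕ} (hq : 0 < q) :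
    (∀ s : M, s ^ i = s ^ (i + q)) ↔ n ≤ i ∧ p ∣ q := by
  constructor
  · intro H
    have := H (f gen)
    rw [← map_pow, ← map_pow, h.eq_iff, monogenicCon_iff, Int.modEq_iff_dvd, gen_pow,
      gen_pow] at this
    rcases this with h' | ⟨h1, -, h2⟩
    · have := congrArg FreeMonogenic.pos h'
      simp only at this
      omega
    · simp only [size] at h1
      refine ⟨by omega, ?_⟩
      rw [← Int.natCast_dvd_natCast]
      convert h2 using 1
      simp
  · rintro ⟨hi, hpq⟩ s
    obtain ⟨u, rfl⟩ := h.surjective s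
    -- Exponent 0 belongs to the other case: there `n = 0`, so every element is long.
    by_cases hu : u.pos = 0 ∧ 0 < i
    · have he : IsIdempotentElem (f u) := (h.isIdempotentElem_iff u).2 (Or.inl hu.1)
      rw [he.pow_eq (by omega), he.pow_eq (by omega)]
    · have hs : ∀ j, i ≤ j → (n : ℤ) ≤ (u ^ j).size := by
        intro j hj
        rcases Nat.eq_zero_or_pos i with h0 | h0
        · have := size_nonneg (u ^ j)
          omega
        · have hp : u.pos ≠ 0 := fun hp => hu ⟨hp, h0⟩
          have h1 := (u ^ j).lo_le_pos
          have h2 := (u ^ j).pos_le_hi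
          have h3 := (u ^ j).lo_nonpos
          have h4 := (u ^ j).hi_nonneg
          have h5 : (j : ℤ) ≤ |(u ^ j).pos| := by
            rw [pow_pos_eq, abs_mul, Nat.abs_cast]
            exact le_mul_of_one_le_right (by omega) (Int.one_le_abs hp)
          simp only [size]
          rcases abs_cases (u ^ j).pos with ⟨h6, -⟩ | ⟨h6, -⟩ <;> omega
      rw [← map_pow, ← map_pow, h.eq_iff, monogenicCon_iff]
      refine Or.inr ⟨hs _ le_rfl, hs _ (by omega), ?_⟩
      rw [Int.modEq_iff_dvd, pow_pos_eq, pow_pos_eq, ← sub_mul]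
      refine Dvd.dvd.mul_right ?_ _
      push_cast
      rw [add_sub_cancel_left]
      exact Int.natCast_dvd_natCast.2 hpq

theorem parameters_unique {N : Type u} [Monoid N] {g : FreeMonogenic →* N} {n' p' : ℕ}
    (h : IsMonogenicPresentation f n p) (h' : IsMonogenicPresentation g n' p')
    (hp : 0 < p) (hp' : 0 < p') (e : M ≃* N) : n = n' ∧ p = p' := by
  have key : ∀ i q : ℕ, 0 < q → ((n ≤ i ∧ p ∣ q) ↔ (n' ≤ i ∧ p' ∣ q)) := by
    intro i q hq
    rw [← h.forall_pow_eq_iff hq, ← h'.forall_pow_eq_iff hq]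
    constructor
    · intro H s
      apply e.symm.injective
      rw [map_pow, map_pow, H]
    · intro H s
      apply e.injective
      rw [map_pow, map_pow, H]
  have h1 := (key n p hp).1 ⟨le_rfl, dvd_rfl⟩
  have h2 := (key n' p' hp').2 ⟨le_rfl, dvd_rfl⟩
  exact ⟨le_antisymm h2.1 h1.1, Nat.dvd_antisymm h2.2 h1.2⟩

theorem nonempty_mulEquiv {N : Type*} [Monoid N] {g : FreeMonogenic →* N}
    (h : IsMonogenicPresentation f n p) (h' : IsMonogenicPresentation g n p) :
    Nonempty (M ≃* N) := by
  have hk : Con.ker f = Con.ker g :=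
    Con.ext fun u v => (h.eq_iff u v).trans (h'.eq_iff u v).symm
  have e := Con.quotientKerEquivOfSurjective f h.surjective
  rw [hk] at e
  exact ⟨e.symm.trans (Con.quotientKerEquivOfSurjective g h'.surjective)⟩

/-- The elements with interval contained in `[-n, n]` together with one long element for each
residue modulo `p` represent all elements. -/
theorem exists_surjective_sum (h : IsMonogenicPresentation f n p) (hp : 0 < p) :
    ∃ r : (Fin (n + 1) × Fin (n + 1) × Fin (2 * n + 1)) ⊕ Fin p → M,
      Function.Surjective r := by
  -- The position is stored with offset `n` and clamped to the interval, so that every triple is a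
  -- valid element.
  refine ⟨Sum.elim (fun t => f ⟨-(t.1 : ℕ), (t.2.1 : ℕ),
    max (-(t.1 : ℕ)) (min (t.2.1 : ℕ) ((t.2.2 : ℕ) - n)),
    by omega, by omega, by omega, by omega⟩) (fun k => f (long n (k : ℕ))), fun x => ?_⟩
  obtain ⟨u, rfl⟩ := h.surjective x
  have h1 := u.lo_le_pos
  have h2 := u.pos_le_hi
  have h3 := u.lo_nonpos
  have h4 := u.hi_nonneg
  by_cases hu : (n : ℤ) ≤ u.size
  · have hp' : (p : ℤ) ≠ 0 := by omega
    have h5 := Int.emod_nonneg u.pos hp'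
    have h6 := Int.emod_lt_of_pos u.pos (by omega : 0 < (p : ℤ))
    refine ⟨Sum.inr ⟨(u.pos % p).toNat, by omega⟩, ?_⟩
    simp only [Sum.elim_inr]
    rw [h.eq_iff, monogenicCon_iff]
    refine Or.inr ⟨le_size_long _ _, hu, ?_⟩
    rw [long_pos, Int.toNat_of_nonneg h5]
    exact Int.mod_modEq _ _
  · simp only [size] at hu
    refine ⟨Sum.inl (⟨(-u.lo).toNat, by omega⟩, ⟨u.hi.toNat, by omega⟩,
      ⟨(u.pos + n).toNat, by omega⟩), ?_⟩
    simp only [Sum.elim_inl]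
    congr 1
    ext
    · simp only; omega
    · simp only; omega
    · simp only; omega

theorem finite (h : IsMonogenicPresentation f n p) (hp : 0 < p) : Finite M := by
  obtain ⟨r, hr⟩ := h.exists_surjective_sum hp
  exact Finite.of_surjective r hr

theorem card_le (h : IsMonogenicPresentation f n p) (hp : 0 < p) :
    Nat.card M ≤ (n + 1) * ((n + 1) * (2 * n + 1)) + p := by
  obtain ⟨r, hr⟩ := h.exists_surjective_sum hp
  simpa using Nat.card_le_card_of_surjective r hr

theorem le_card (h : IsMonogenicPresentation f n p) [Finite M] : p ≤ Nat.card M := by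
  have hinj : Function.Injective fun k : Fin p => f (long n (k : ℕ)) := by
    intro k l hkl
    have := k.2
    have := l.2
    have hkl' := (h.eq_iff _ _).1 hkl
    have hm : ((k : ℕ) : ℤ) ≡ ((l : ℕ) : ℤ) [ZMOD p] := by
      rcases hkl' with h' | ⟨-, -, h'⟩
      · exact congrArg (· % (p : ℤ)) (congrArg FreeMonogenic.pos h')
      · exact h'
    rw [Int.natCast_modEq_iff] at hm
    exact Fin.ext (hm.eq_of_lt_of_lt k.2 l.2)
  simpa using Nat.card_le_card_of_injective _ hinj

/-- Both arms are at most `(n + 1) / 2 - 1`, so these idempotents have length below `n` and stay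
distinct. -/
theorem sq_le_card (h : IsMonogenicPresentation f n p) [Finite M] :
    ((n + 1) / 2) * ((n + 1) / 2) ≤ Nat.card M := by
  have hinj : Function.Injective
      fun t : Fin ((n + 1) / 2) × Fin ((n + 1) / 2) => f (idem (t.1 : ℕ) (t.2 : ℕ)) := by
    rintro ⟨a, b⟩ ⟨c, d⟩ ht
    have ha := a.2
    have hb := b.2
    rcases (h.eq_iff _ _).1 ht with h' | ⟨h', -, -⟩
    · have h1 := congrArg FreeMonogenic.lo h'
      have h2 := congrArg FreeMonogenic.hi h'
      simp only [idem_lo, idem_hi] at h1 h2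
      ext <;> simp only <;> omega
    · simp only [size, idem_lo, idem_hi] at h'
      omega
  simpa using Nat.card_le_card_of_injective _ hinj

/-- For `1 ≤ n ≤ p` the reduction of positions modulo `p` is a nontrivial idempotent-pure
congruence. -/
theorem not_isEDisjunctive (h : IsMonogenicPresentation f n p) (hn : 0 < n) (hnp : n ≤ p) :
    ¬ IsEDisjunctive M := by
  intro hE
  let c : Con M :=
    { r := fun s t => ∃ u v, f u = s ∧ f v = t ∧ u.pos ≡ v.pos [ZMOD p]
      iseqv :=
        { refl := fun s => by
            obtain ⟨u, rfl⟩ := h.surjective s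
            exact ⟨u, u, rfl, rfl, rfl⟩
          symm := by
            rintro _ _ ⟨u, v, hu, hv, huv⟩
            exact ⟨v, u, hv, hu, huv.symm⟩
          trans := by
            rintro _ _ _ ⟨u, v, hu, hv, huv⟩ ⟨v', w, hv', hw, hvw⟩
            refine ⟨u, w, hu, hw, huv.trans (Int.ModEq.trans ?_ hvw)⟩
            -- The position of an element of `M` is well defined modulo `p`.
            rcases (h.eq_iff v v').1 (hv.trans hv'.symm) with rfl | ⟨-, -, h'⟩
            · rfl
            · exact h' }
      mul' := by
        rintro _ _ _ _ ⟨u, v, rfl, rfl, huv⟩ ⟨u', v', rfl, rfl, huv'⟩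
        exact ⟨u * u', v * v', map_mul _ _ _, map_mul _ _ _, huv.add huv'⟩ }
  have hc : c = ⊥ := by
    refine hE c ?_
    rintro _ _ ⟨u, v, rfl, rfl, huv⟩ he
    rw [h.isIdempotentElem_iff] at he ⊢
    have hv : (p : ℤ) ∣ v.pos := by
      rcases he with he | ⟨-, he⟩
      · rw [he]; exact dvd_zero _
      · exact he
    have hu : (p : ℤ) ∣ u.pos := (Int.ModEq.dvd_iff huv).2 hv
    by_cases hs : (n : ℤ) ≤ u.size
    · exact Or.inr ⟨hs, hu⟩
    · left
      have h1 := u.lo_le_pos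
      have h2 := u.pos_le_hi
      have h3 := u.lo_nonpos
      have h4 := u.hi_nonneg
      simp only [size] at hs
      -- A short element has `|pos| ≤ size < n ≤ p`.
      refine Int.eq_zero_of_abs_lt_dvd hu ?_
      rw [abs_lt]
      omega
  have h1 : c (f 1) (f (long n 0)) := ⟨_, _, rfl, rfl, rfl⟩
  rw [hc] at h1
  rcases (h.eq_iff _ _).1 h1 with h1 | ⟨h1, -, -⟩
  · have := congrArg FreeMonogenic.lo h1
    simp [long] at this
    omega
  · simp only [size, one_lo, one_hi] at h1
    omega

end IsMonogenicPresentation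

/-! ### Counting isomorphism classes -/

theorem IsMonogenicInverseMonoid.exists_presentation {M : Type u} [Monoid M] [Finite M]
    (hM : IsMonogenicInverseMonoid M) : ∃ (f : FreeMonogenic →* M) (n p : ℕ), 0 < p ∧
      IsMonogenicPresentation f n p := by
  obtain ⟨f, hf⟩ := hM.exists_surjective
  obtain ⟨n, p, hp, h⟩ := exists_ker_eq_monogenicCon (f := f) hM.1
  exact ⟨f, n, p, hp, hf, h⟩

/-- The quotient of the free monogenic inverse monoid by `monogenicCon n p`. -/
abbrev MonogenicQuotient (n p : ℕ) : Type u := ULift.{u} (monogenicCon n p).Quotient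

/-- The canonical map onto `MonogenicQuotient n p`. -/
def monogenicQuotientMk (n p : ℕ) : FreeMonogenic →* MonogenicQuotient.{u} n p :=
  MulEquiv.ulift.symm.toMonoidHom.comp (monogenicCon n p).mk'

theorem isMonogenicPresentation_mk (n p : ℕ) :
    IsMonogenicPresentation (monogenicQuotientMk.{u} n p) n p where
  surjective := MulEquiv.ulift.symm.surjective.comp (Con.mk'_surjective)
  eq_iff _ _ := (MulEquiv.ulift.symm.injective.eq_iff).trans (Con.eq _)

/-- The isomorphism class of `MonogenicQuotient n p`. -/
def monogenicClass (t : ℕ × ℕ) : MonoidIsoClass.{u} :=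
  Quotient.mk monoidIsoSetoid (MonCat.of (MonogenicQuotient.{u} t.1 t.2))

theorem monogenicClass_injOn : Set.InjOn monogenicClass.{u} {t | 0 < t.2} := by
  rintro ⟨n, p⟩ hp ⟨n', p'⟩ hp' h
  obtain ⟨e⟩ := Quotient.exact h
  obtain ⟨rfl, rfl⟩ := (isMonogenicPresentation_mk n p).parameters_unique
    (isMonogenicPresentation_mk n' p') hp hp' e
  rfl

theorem monogenicClass_mem {n p m : ℕ} (hp : 0 < p)
    (hm : (n + 1) * ((n + 1) * (2 * n + 1)) + p ≤ m) :
    monogenicClass.{u} (n, p) ∈ monogenicClasses.{u} m :=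
  have h := isMonogenicPresentation_mk.{u} n p
  ⟨_, rfl, h.isMonogenicInverseMonoid, h.finite hp, (h.card_le hp).trans hm⟩

theorem exists_eq_monogenicClass {M : MonCat.{u}} (hM : IsMonogenicInverseMonoid M) [Finite M]
    {m : ℕ} (hm : Nat.card M ≤ m) : ∃ n p : ℕ, n ≤ 2 * m.sqrt ∧ p ≤ m ∧
      (IsEDisjunctive M → n = 0 ∨ p < n) ∧
      Quotient.mk monoidIsoSetoid M = monogenicClass.{u} (n, p) := by
  obtain ⟨f, n, p, hp, h⟩ := hM.exists_presentation
  refine ⟨n, p, ?_, h.le_card.trans hm, fun hE => ?_, ?_⟩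
  · have := Nat.le_sqrt.2 (h.sq_le_card.trans hm)
    omega
  · by_contra! hcon
    exact h.not_isEDisjunctive (Nat.pos_of_ne_zero hcon.1) hcon.2 hE
  · exact Quotient.sound (h.nonempty_mulEquiv (isMonogenicPresentation_mk n p))

theorem finite_monogenicClasses (m : ℕ) : (monogenicClasses.{u} m).Finite := by
  refine ((Finset.range (2 * m.sqrt + 1) ×ˢ Finset.range (m + 1)).finite_toSet.image
    monogenicClass.{u}).subset ?_
  rintro _ ⟨M, rfl, hM, hfin, hm⟩
  obtain ⟨n, p, hn, hp, -, h⟩ := exists_eq_monogenicClass hM hm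
  refine ⟨(n, p), ?_, h.symm⟩
  simp
  omega

/-- The pairs lie in the column `n = 0`, `p ≤ m` or in the square `p, n ≤ 2√m`; together these have
at most `(m + 1) + (2√m + 1)² ≤ 9m + 2` points. -/
theorem ncard_eDisjunctiveMonogenicClasses_le {m : ℕ} (hm : 1 ≤ m) :
    (eDisjunctiveMonogenicClasses.{u} m).ncard ≤ 11 * m := by
  classical
  let S : Finset (ℕ × ℕ) := {0} ×ˢ Finset.range (m + 1) ∪
    Finset.range (2 * m.sqrt + 1) ×ˢ Finset.range (2 * m.sqrt + 1)
  have hsub : eDisjunctiveMonogenicClasses.{u} m ⊆ monogenicClass.{u} '' (S : Set (ℕ × ℕ)) := by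
    rintro _ ⟨M, rfl, hM, hE, hfin, hm⟩
    obtain ⟨n, p, hn, hp, hnp, h⟩ := exists_eq_monogenicClass hM hm
    refine ⟨(n, p), ?_, h.symm⟩
    have := hnp hE
    simp only [S, Finset.coe_union, Set.mem_union, Finset.mem_coe, Finset.mem_product,
      Finset.mem_singleton, Finset.mem_range]
    omega
  have hS : S.card ≤ 11 * m := by
    refine (Finset.card_union_le _ _).trans ?_
    simp only [Finset.card_product, Finset.card_singleton, Finset.card_range]
    have h1 := Nat.sqrt_le m
    have h2 := Nat.sqrt_le_self m
    nlinarith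
  calc (eDisjunctiveMonogenicClasses.{u} m).ncard
      ≤ (monogenicClass.{u} '' (S : Set (ℕ × ℕ))).ncard :=
        Set.ncard_le_ncard hsub (S.finite_toSet.image _)
    _ ≤ (S : Set (ℕ × ℕ)).ncard := Set.ncard_image_le S.finite_toSet
    _ ≤ 11 * m := by rwa [Set.ncard_coe_finset]

/-- For `n ≤ K` the short elements cost at most a constant, leaving all remaining room for `p`. The
slope `K + 1` is arbitrary, which beats any linear bound. -/
theorem le_ncard_monogenicClasses (K m : ℕ) :
    (K + 1) * (m - (K + 1) * ((K + 1) * (2 * K + 1))) ≤ (monogenicClasses.{u} m).ncard := by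
  let S : Finset (ℕ × ℕ) :=
    Finset.range (K + 1) ×ˢ Finset.Icc 1 (m - (K + 1) * ((K + 1) * (2 * K + 1)))
  have hS : S.card = (K + 1) * (m - (K + 1) * ((K + 1) * (2 * K + 1))) := by
    simp [S]
  rw [← hS, ← Set.ncard_coe_finset, ← Set.InjOn.ncard_image (f := monogenicClass.{u})]
  · refine Set.ncard_le_ncard ?_ (finite_monogenicClasses m)
    rintro _ ⟨⟨n, p⟩, ht, rfl⟩
    simp only [S, Finset.mem_coe, Finset.mem_product, Finset.mem_range, Finset.mem_Icc] at ht
    obtain ⟨hn, hp, hp'⟩ := ht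
    have hn' : n ≤ K := by omega
    have : (n + 1) * ((n + 1) * (2 * n + 1)) ≤ (K + 1) * ((K + 1) * (2 * K + 1)) := by gcongr
    exact monogenicClass_mem hp (by omega)
  · refine monogenicClass_injOn.mono fun t ht => ?_
    simp only [S, Finset.mem_coe, Finset.mem_product, Finset.mem_Icc] at ht
    exact ht.2.1

theorem nonempty_monogenicClasses {m : ℕ} (hm : 1 ≤ m) : (monogenicClasses.{u} m).Nonempty := by
  have h := isMonogenicPresentation_mk.{u} 0 1
  have : Subsingleton (MonogenicQuotient.{u} 0 1) := ⟨fun s t => by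
    obtain ⟨a, rfl⟩ := h.surjective s
    obtain ⟨b, rfl⟩ := h.surjective t
    rw [h.eq_iff, monogenicCon_iff]
    exact Or.inr ⟨size_nonneg _, size_nonneg _, Int.modEq_one⟩⟩
  refine ⟨_, MonCat.of _, rfl, h.isMonogenicInverseMonoid, h.finite one_pos, ?_⟩
  exact (Finite.card_le_one_iff_subsingleton.2 this).trans hm

theorem mainTheorem8 :
    (∀ m : ℕ, (monogenicClasses.{u} m).Finite) ∧
    (∀ m : ℕ, 1 ≤ m → (monogenicClasses.{u} m).Nonempty) ∧
    Tendsto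
      (fun m : ℕ =>
        ((eDisjunctiveMonogenicClasses.{u} m).ncard : ℝ) / ((monogenicClasses.{u} m).ncard : ℝ))
      atTop (𝓝 0) := by
  refine ⟨finite_monogenicClasses, fun m => nonempty_monogenicClasses, ?_⟩
  rw [Metric.tendsto_atTop]
  intro ε hε
  -- For `m > 2C` one has `m ≤ 2(m - C)`, so `A ≥ (K + 1) m / 2`; with `B ≤ 11m` the ratio is at
  -- most `22 / (K + 1)`.
  obtain ⟨K, hK⟩ := exists_nat_gt (22 / ε)
  let C := (K + 1) * ((K + 1) * (2 * K + 1))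
  refine ⟨2 * C + 1, fun m hm => ?_⟩
  have hB : ((eDisjunctiveMonogenicClasses.{u} m).ncard : ℝ) ≤ 11 * m := by
    exact_mod_cast ncard_eDisjunctiveMonogenicClasses_le.{u} (m := m) (by omega)
  have hA : ((K : ℝ) + 1) * m ≤ 2 * ((monogenicClasses.{u} m).ncard : ℝ) := by
    have h1 : (K + 1) * (m - C) ≤ (monogenicClasses.{u} m).ncard :=
      le_ncard_monogenicClasses K m
    have h2 : (K + 1) * m ≤ (K + 1) * (2 * (m - C)) := Nat.mul_le_mul_left _ (by omega)
    have h3 : (K + 1) * m ≤ 2 * (monogenicClasses.{u} m).ncard := by linarith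
    exact_mod_cast h3
  have hm0 : (0 : ℝ) < m := by exact_mod_cast (by omega : 0 < m)
  have hApos : (0 : ℝ) < (monogenicClasses.{u} m).ncard := by
    have : 0 < ((K : ℝ) + 1) * m := by positivity
    linarith
  rw [Real.dist_eq, sub_zero, abs_of_nonneg (by positivity), div_lt_iff₀ hApos]
  rw [div_lt_iff₀ hε] at hK
  have h4 : 22 * (m : ℝ) < K * ε * m := by gcongr
  have h5 := mul_le_mul_of_nonneg_left hA hε.le
  nlinarith [mul_pos hε hm0]
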